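/- Let $n,m\ge 1$ be integers, and let $\mathbf q=\|q_{ij}\|_{0\le i,j\le n}$ and $\mathbf q'=\|q'_{\alpha\beta}\|_{0\le\alpha,\beta\le m}$ be multiplicatively anti-symmetric complex matrices (all entries nonzero, $q_{ji}=q_{ij}^{-1}$, $q_{ii}=1$, and likewise for $\mathbf q'$). For such a matrix, let $\mathcal A^n_{\mathbf q}$ be the quantum space, that is, the unital associative $\mathbb C$-algebra with generators $x_0,\dots,x_n$ and relations $x_jx_i=q_{ji}x_ix_j$ for $0\le i<j\le n$; define in the same way $\mathcal A^m_{\mathbf q'}$ with generators $y_0,\dots,y_m$. Put $N=(n+1)(m+1)-1$ and let $\mathcal A^N_{\mathbf g}$ be the quantum space with generators $z_{i\alpha}$ ($0\le i\le n$, $0\le\alpha\le m$), ordered lexicographically by $(i,\alpha)$, and with $\mathbf g$ the Kronecker product of $\mathbf q$ and $\mathbf q'$, $g_{i\alpha,j\beta}=q_{ij}q'_{\alpha\beta}$. The Segre map $$s_{n,m}:\mathcal A^N_{\mathbf g}\to\mathcal A^n_{\mathbf q}\otimes\mathcal A^m_{\mathbf q'},\qquad z_{i\alpha}\mapsto x_i\otimes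 y_\alpha,$$ is a well-defined homomorphism of $\mathbb C$-algebras. The ordered monomials (products $z_{i_1\alpha_1}\cdots z_{i_d\alpha_d}$ of generators in non-decreasing order) form a $\mathbb C$-basis of $\mathcal A^N_{\mathbf g}$. Order them degree-lexicographically as words (by length, and for equal lengths lexicographically), let $\mathbf{LM}(f)$ be the largest ordered monomial that occurs in $f\ne 0$, and put $u\star v=\mathbf{LM}(uv)$ for ordered monomials $u,v$. A subset $F$ of a two-sided ideal $\mathfrak K$ is a Gröbner basis of $\mathfrak K$ if for every nonzero $h\in\mathfrak K$ there are a nonzero $f\in F$ and ordered monomials $a,b$ with $\mathbf{LM}(h)=a\star\mathbf{LM}(f)\star b$. It is reduced if, moreover, it generates $\mathfrak K$ as a two-sided ideal, its elements are monic (the coefficient of $\mathbf{LM}(f)$ in $f$ is $1$), no $F\setminus\{f\}$ with $f\in F$ is a Gröbner basis of $\mathfrak K$, and no ordered monomial that occurs in some $f\in F$ is of the form $a\star\mathbf{LM}(g)\star b$ with $g\in F\setminus\{f\}$, $g \neq 0$, and $a,b$ ordered monomials. Then the set $$\mathcal R^{\mathrm s}_{\mathbf q,\mathbf q'}=\{\,z_{i\beta}z_{j\alpha}-q'_{\beta\alpha}z_{i\alpha}z_{j\beta}\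 \mid\ 0\le i<j\le n,\ 0\le\alpha<\beta\le m\,\}\subset\mathcal A^N_{\mathbf g}$$ has exactly $\binom{n+1}{2}\binom{m+1}{2}$ elements and is a reduced Gröbner basis of the kernel of $s_{n,m}$. -/

import Mathlib

open scoped TensorProduct Kronecker

noncomputable section

/-! ## Quantum spaces -/

/-- A square complex matrix is multiplicatively anti-symmetric if its entries are nonzero,
`q j i = (q i j)⁻¹`, and the diagonal entries are `1`. -/
structure IsMultAntisymm {I : Type*} (q : Matrix I I ℂ) : Prop where
  ne_zero : ∀ i j, q i j ≠ 0
  inv_eq : ∀ i j, q j i = (q i j)⁻¹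
  diag : ∀ i, q i i = 1

/-- The relations `x_j x_i = q_{ji} x_i x_j` for `i < j`, in the free algebra on the `x_i`. -/
inductive QuantumRel {I : Type*} [LinearOrder I] (q : Matrix I I ℂ) :
    FreeAlgebra ℂ I → FreeAlgebra ℂ I → Prop
  | comm (i j : I) (h : i < j) :
      QuantumRel q (FreeAlgebra.ι ℂ j * FreeAlgebra.ι ℂ i)
        (q j i • (FreeAlgebra.ι ℂ i * FreeAlgebra.ι ℂ j))

/-- The quantum space defined by `q`: the complex algebra with generators `x_i` indexed by the
linearly ordered set `I` and relations `x_j x_i - q_{ji} x_i x_j`, for `i < j`. -/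
abbrev QuantumSpace {I : Type*} [LinearOrder I] (q : Matrix I I ℂ) : Type _ :=
  RingQuot (QuantumRel q)

namespace QuantumSpace

variable {I : Type*} [LinearOrder I]

/-- The generator `x_i` of the quantum space. -/
def gen (q : Matrix I I ℂ) (i : I) : QuantumSpace q :=
  RingQuot.mkAlgHom ℂ (QuantumRel q) (FreeAlgebra.ι ℂ i)

theorem gen_mul_gen_of_lt (q : Matrix I I ℂ) {i j : I} (h : i < j) :
    gen q j * gen q i = q j i • (gen q i * gen q j) := by
  have := RingQuot.mkAlgHom_rel ℂ (QuantumRel.comm (q := q) i j h)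
  simpa [gen] using this

theorem gen_mul_gen (q : Matrix I I ℂ) (hq : IsMultAntisymm q) (i j : I) :
    gen q i * gen q j = q i j • (gen q j * gen q i) := by
  rcases lt_trichotomy i j with h | rfl | h
  · rw [gen_mul_gen_of_lt q h, smul_smul, hq.inv_eq i j, mul_inv_cancel₀ (hq.ne_zero i j),
      one_smul]
  · rw [hq.diag, one_smul]
  · exact gen_mul_gen_of_lt q h

/-- Universal property: elements `a i` of an algebra that satisfy the defining relations
determine an algebra homomorphism with `x_i ↦ a i`. -/
def lift {B : Type*} [Ring B] [Algebra ℂ B] (q : Matrix I I ℂ) (a : I → B)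
    (h : ∀ i j, i < j → a j * a i = q j i • (a i * a j)) : QuantumSpace q →ₐ[ℂ] B :=
  RingQuot.liftAlgHom ℂ ⟨FreeAlgebra.lift ℂ a, by
    rintro _ _ ⟨i, j, hij⟩
    simpa using h i j hij⟩

@[simp] theorem lift_gen {B : Type*} [Ring B] [Algebra ℂ B] (q : Matrix I I ℂ) (a : I → B)
    (h : ∀ i j, i < j → a j * a i = q j i • (a i * a j)) (i : I) :
    lift q a h (gen q i) = a i := by
  simp [lift, gen]

theorem induction_left (q : Matrix I I ℂ) (S : Submodule ℂ (QuantumSpace q)) (h1 : 1 ∈ S)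
    (hgen : ∀ i, ∀ f ∈ S, gen q i * f ∈ S) (f : QuantumSpace q) : f ∈ S := by
  obtain ⟨p, rfl⟩ := RingQuot.mkAlgHom_surjective ℂ (QuantumRel q) f
  suffices H : ∀ g ∈ S, RingQuot.mkAlgHom ℂ (QuantumRel q) p * g ∈ S by
    simpa using H 1 h1
  induction p using FreeAlgebra.induction with
  | grade0 r =>
    intro g hg
    rw [AlgHom.commutes, ← Algebra.smul_def]
    exact S.smul_mem r hg
  | grade1 i => exact fun g hg => hgen i g hg
  | mul a b ha hb =>
    intro g hg
    rw [map_mul, mul_assoc]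
    exact ha _ (hb _ hg)
  | add a b ha hb =>
    intro g hg
    rw [map_add, add_mul]
    exact S.add_mem (ha _ hg) (hb _ hg)

end QuantumSpace

/-! ## Ordered monomials and the degree-lexicographic order -/

/-- Ordered monomials (terms) `x_{i_1} x_{i_2} ⋯ x_{i_d}`, `i_1 ≤ i_2 ≤ ⋯ ≤ i_d`, as words. -/
@[ext] structure Term (I : Type*) [LinearOrder I] where
  word : List I
  sorted : word.Pairwise (· ≤ ·)

namespace Term

variable {I : Type*} [LinearOrder I]

/-- The empty word. -/
def one : Term I := ⟨[], List.Pairwise.nil⟩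

/-- Length first, then the word lexicographically. -/
def key (w : Term I) : ℕ ×ₗ List I := toLex (w.word.length, w.word)

theorem key_injective : Function.Injective (key (I := I)) := by
  intro u v h
  have h2 : (ofLex (key u)).2 = (ofLex (key v)).2 := by rw [h]
  exact Term.ext h2

/-- The restriction to ordered monomials of the degree-lexicographic order on words. -/
instance : LinearOrder (Term I) := LinearOrder.lift' key key_injective

/-- Insertion of a letter at its place in an ordered monomial. -/
def insert (i : I) (w : Term I) : Term I :=
  ⟨w.word.orderedInsert (· ≤ ·) i, w.sorted.orderedInsert i _⟩

theorem insert_comm (i j : I) (w : Term I) : insert i (insert j w) = insert j (insert i w) := by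
  apply Term.ext
  refine List.Perm.eq_of_pairwise' (r := (· ≤ ·)) (insert i (insert j w)).sorted
    (insert j (insert i w)).sorted ?_
  refine (List.perm_orderedInsert _ _ _).trans
    (((List.perm_orderedInsert _ _ _).cons i).trans ?_)
  refine (List.Perm.swap _ _ _).trans ?_
  exact (((List.perm_orderedInsert (· ≤ ·) i w.word).cons j).symm.trans
    (List.perm_orderedInsert (· ≤ ·) j _).symm)

end Term

namespace QuantumSpace

variable {I : Type*} [LinearOrder I]

/-- The ordered monomial `w`, as an element of the quantum space. -/
def mon (q : Matrix I I ℂ) (w : Term I) : QuantumSpace q := (w.word.map (gen q)).prod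

/-! ## Normal forms

The ordered monomials are a basis of the quantum space. The coordinates are computed by letting
the quantum space act on the free vector space on the ordered monomials. -/

/-- The scalar that appears when `x_i` is moved to its place in an ordered monomial. -/
def coeff (q : Matrix I I ℂ) (i : I) (l : List I) : ℂ :=
  (l.map fun k => if k < i then q i k else 1).prod

theorem coeff_insert (q : Matrix I I ℂ) (i j : I) (w : Term I) :
    coeff q j (Term.insert i w).word = (if i < j then q j i else 1) * coeff q j w.word := by
  have h := (List.perm_orderedInsert (· ≤ ·) i w.word).map (fun k => if k < j then q j k else 1)
  exact h.prod_eq.trans (by simp [coeff])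

theorem coeff_eq_one (q : Matrix I I ℂ) (i : I) (l : List I) (h : ∀ k ∈ l, i ≤ k) :
    coeff q i l = 1 := by
  unfold coeff
  apply List.prod_eq_one
  intro x hx
  obtain ⟨k, hk, rfl⟩ := List.mem_map.1 hx
  simp [not_lt.2 (h k hk)]

/-- Left multiplication by `x_i` on the free vector space on the ordered monomials. -/
def act (q : Matrix I I ℂ) (i : I) : Module.End ℂ (Term I →₀ ℂ) :=
  Finsupp.lsum ℂ fun w =>
    coeff q i w.word • Finsupp.lsingle (Term.insert i w)

theorem act_single (q : Matrix I I ℂ) (i : I) (w : Term I) (c : ℂ) :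
    act q i (Finsupp.single w c) = Finsupp.single (Term.insert i w) (coeff q i w.word * c) := by
  simp [act]

/-- The action of the quantum space on the free vector space on the ordered monomials. -/
def rep (q : Matrix I I ℂ) : QuantumSpace q →ₐ[ℂ] Module.End ℂ (Term I →₀ ℂ) :=
  lift q (act q) (by
    intro i j h
    refine Finsupp.lhom_ext fun w c => ?_
    simp only [Module.End.mul_apply, LinearMap.smul_apply, act_single, coeff_insert,
      Finsupp.smul_single, smul_eq_mul]
    rw [Term.insert_comm, if_pos h, if_neg h.not_gt]
    congr 1
    ring)

/-- The coefficients of the normal form. -/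
def nor (q : Matrix I I ℂ) : QuantumSpace q →ₗ[ℂ] (Term I →₀ ℂ) :=
  (LinearMap.applyₗ (Finsupp.single Term.one (1 : ℂ))).comp (rep q).toLinearMap

theorem nor_mon (q : Matrix I I ℂ) (w : Term I) : nor q (mon q w) = Finsupp.single w 1 := by
  obtain ⟨l, hl⟩ := w
  induction l with
  | nil => simp [nor, mon, Term.one]
  | cons i l ih =>
    have hl' := List.pairwise_cons.1 hl
    have h := ih hl'.2
    simp only [nor, mon, LinearMap.comp_apply, AlgHom.toLinearMap_apply,
      LinearMap.applyₗ_apply_apply, List.map_cons, List.prod_cons, map_mul,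
      Module.End.mul_apply] at h ⊢
    rw [h, rep, lift_gen, act_single, coeff_eq_one q i l hl'.1, one_mul]
    congr 1
    apply Term.ext
    cases l with
    | nil => rfl
    | cons k l => exact List.orderedInsert_cons_of_le _ _ (hl'.1 k List.mem_cons_self)

theorem gen_mul_mon (q : Matrix I I ℂ) (i : I) (w : Term I) :
    gen q i * mon q w = coeff q i w.word • mon q (Term.insert i w) := by
  obtain ⟨l, hl⟩ := w
  induction l with
  | nil => simp [mon, coeff, Term.insert]
  | cons k l ih =>
    have hl' := List.pairwise_cons.1 hl
    by_cases hik : i ≤ k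
    · have h1 : ∀ a ∈ k :: l, i ≤ a := by
        intro a ha
        rcases List.mem_cons.1 ha with rfl | ha
        · exact hik
        · exact hik.trans (hl'.1 a ha)
      rw [coeff_eq_one q i _ h1, one_smul]
      simp [mon, Term.insert, hik]
    · have hki := not_le.1 hik
      have h := ih hl'.2
      simp only [mon, Term.insert, List.map_cons, List.prod_cons] at h ⊢
      rw [List.orderedInsert_of_not_le _ _ hik, ← mul_assoc, gen_mul_gen_of_lt q hki,
        smul_mul_assoc, mul_assoc, h, mul_smul_comm, smul_smul, List.map_cons, List.prod_cons]
      simp [coeff, hki]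

/-- The linear combination of ordered monomials with given coefficients. -/
def ofNor (q : Matrix I I ℂ) : (Term I →₀ ℂ) →ₗ[ℂ] QuantumSpace q :=
  Finsupp.linearCombination ℂ (mon q)

theorem nor_ofNor (q : Matrix I I ℂ) (c : Term I →₀ ℂ) : nor q (ofNor q c) = c := by
  induction c using Finsupp.induction_linear with
  | zero => simp
  | add a b ha hb => rw [map_add, map_add, ha, hb]
  | single w c => simp [ofNor, nor_mon]

theorem ofNor_surjective (q : Matrix I I ℂ) : Function.Surjective (ofNor q) := by
  rw [← LinearMap.range_eq_top, eq_top_iff]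
  rintro f -
  refine induction_left q (LinearMap.range (ofNor q))
    ⟨Finsupp.single Term.one 1, by simp [ofNor, mon, Term.one]⟩ ?_ f
  rintro i _ ⟨c, rfl⟩
  induction c using Finsupp.induction_linear with
  | zero => simp
  | add a b ha hb =>
    rw [map_add, mul_add]
    exact Submodule.add_mem _ ha hb
  | single w c =>
    refine ⟨Finsupp.single (Term.insert i w) (c * coeff q i w.word), ?_⟩
    rw [ofNor, Finsupp.linearCombination_single, Finsupp.linearCombination_single,
      mul_smul_comm, gen_mul_mon, smul_smul]

/-- The normal form: the unique way to write an element of the quantum space as a linear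
combination of ordered monomials. -/
def normalForm (q : Matrix I I ℂ) : QuantumSpace q ≃ₗ[ℂ] (Term I →₀ ℂ) :=
  LinearEquiv.ofLinearMap (nor q) (ofNor q) (LinearMap.ext (nor_ofNor q)) (by
    refine LinearMap.ext fun f => ?_
    obtain ⟨c, rfl⟩ := ofNor_surjective q f
    simp [nor_ofNor])

theorem normalForm_mon (q : Matrix I I ℂ) (w : Term I) :
    normalForm q (mon q w) = Finsupp.single w 1 := nor_mon q w

theorem normalForm_symm_apply (q : Matrix I I ℂ) (c : Term I →₀ ℂ) :
    (normalForm q).symm c = Finsupp.linearCombination ℂ (mon q) c := rfl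

/-! ## Gröbner bases in quantum spaces -/

/-- The leading monomial of `f`: the largest ordered monomial in the normal form of `f`, with
respect to the degree-lexicographic order. By convention it is the empty word if `f = 0`. -/
def leadingMonomial (q : Matrix I I ℂ) (f : QuantumSpace q) : Term I :=
  (normalForm q f).support.max.unbotD Term.one

/-- The operation `u ⋆ v = LM (u v)` on ordered monomials. -/
def starMul (q : Matrix I I ℂ) (u v : Term I) : Term I :=
  leadingMonomial q (mon q u * mon q v)

/-- `F` is a Gröbner basis of the two-sided ideal `K`: it is contained in `K`, and the leading
monomial of every nonzero `h` in `K` is `a ⋆ LM f ⋆ b` for some nonzero `f` in `F` and some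
ordered monomials `a` and `b`. -/
def IsGroebnerBasis (q : Matrix I I ℂ) (K : TwoSidedIdeal (QuantumSpace q))
    (F : Set (QuantumSpace q)) : Prop :=
  (∀ f ∈ F, f ∈ K) ∧
  ∀ h ∈ K, h ≠ 0 → ∃ f ∈ F, f ≠ 0 ∧ ∃ a b : Term I,
    leadingMonomial q h = starMul q (starMul q a (leadingMonomial q f)) b

/-- The ordered monomial `w` is normal modulo `P`: it is not a multiple, for the operation `⋆`,
of the leading monomial of a nonzero element of `P`. -/
def IsNormal (q : Matrix I I ℂ) (P : Set (QuantumSpace q)) (w : Term I) : Prop :=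
  ∀ f ∈ P, f ≠ 0 → ∀ a b : Term I, w ≠ starMul q (starMul q a (leadingMonomial q f)) b

/-- `F` is a reduced Gröbner basis of `K`: a Gröbner basis that generates `K` as a two-sided
ideal, consists of monic elements, is minimal, and in which every `f` is a linear combination of
ordered monomials that are normal modulo `F \ {f}`. -/
structure IsReducedGroebnerBasis (q : Matrix I I ℂ) (K : TwoSidedIdeal (QuantumSpace q))
    (F : Set (QuantumSpace q)) : Prop where
  isGroebnerBasis : IsGroebnerBasis q K F
  span_eq : TwoSidedIdeal.span F = K
  monic : ∀ f ∈ F, normalForm q f (leadingMonomial q f) = 1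
  minimal : ∀ f ∈ F, ¬ IsGroebnerBasis q K (F \ {f})
  reduced : ∀ f ∈ F, ∀ w ∈ (normalForm q f).support, IsNormal q (F \ {f}) w

end QuantumSpace

/-! ## The Segre map -/

/-- The Kronecker product `g_{iα,jβ} = q_{ij} q'_{αβ}`, with the pairs of indices ordered
lexicographically. -/
def segreMatrix {I J : Type*} (q : Matrix I I ℂ) (q' : Matrix J J ℂ) :
    Matrix (I ×ₗ J) (I ×ₗ J) ℂ :=
  Matrix.reindex toLex toLex (q ⊗ₖ q')

/-- The generator `z_{iα}` of the quantum space of the Kronecker product. -/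
def zGen {I J : Type*} [LinearOrder I] [LinearOrder J] (q : Matrix I I ℂ) (q' : Matrix J J ℂ)
    (i : I) (α : J) : QuantumSpace (segreMatrix q q') :=
  QuantumSpace.gen (segreMatrix q q') (toLex (i, α))

/-- The Segre map, the algebra homomorphism with `z_{iα} ↦ x_i ⊗ y_α`. -/
def segreMap {I J : Type*} [LinearOrder I] [LinearOrder J] (q : Matrix I I ℂ) (q' : Matrix J J ℂ)
    (hq : IsMultAntisymm q) (hq' : IsMultAntisymm q') :
    QuantumSpace (segreMatrix q q') →ₐ[ℂ] QuantumSpace q ⊗[ℂ] QuantumSpace q' :=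
  QuantumSpace.lift (segreMatrix q q')
    (fun p => QuantumSpace.gen q (ofLex p).1 ⊗ₜ[ℂ] QuantumSpace.gen q' (ofLex p).2) (by
      intro u v _
      rw [Algebra.TensorProduct.tmul_mul_tmul, Algebra.TensorProduct.tmul_mul_tmul,
        QuantumSpace.gen_mul_gen q hq (ofLex v).1, QuantumSpace.gen_mul_gen q' hq' (ofLex v).2,
        TensorProduct.smul_tmul_smul]
      rfl)

theorem segreMap_zGen {I J : Type*} [LinearOrder I] [LinearOrder J] (q : Matrix I I ℂ)
    (q' : Matrix J J ℂ) (hq : IsMultAntisymm q) (hq' : IsMultAntisymm q') (i : I) (α : J) :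
    segreMap q q' hq hq' (zGen q q' i α) = QuantumSpace.gen q i ⊗ₜ[ℂ] QuantumSpace.gen q' α := by
  simp [segreMap, zGen]

/-- The binomials `z_{iβ} z_{jα} - q'_{βα} z_{iα} z_{jβ}`, for `i < j` and `α < β`. -/
def segreBinomials {I J : Type*} [LinearOrder I] [LinearOrder J] (q : Matrix I I ℂ)
    (q' : Matrix J J ℂ) : Set (QuantumSpace (segreMatrix q q')) :=
  {f | ∃ (i j : I) (α β : J), i < j ∧ α < β ∧
    f = zGen q q' i β * zGen q q' j α - q' β α • (zGen q q' i α * zGen q q' j β)}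

end

/-!
Since all the entries of the matrices are nonzero, a product of generators of a quantum space is a
nonzero multiple of the ordered monomial with the same letters (`exists_prod_gen_eq_smul_mon`).
Therefore `⋆` is the commutative product of monomials, and divisibility for `⋆` is inclusion of
multisets of letters. The leading monomial of a binomial is `z_{iβ} z_{jα}`, so an ordered
monomial `z_{i_1α_1} ⋯ z_{i_dα_d}` is not divisible by any of these exactly when
`α_1 ≤ ⋯ ≤ α_d`; its first indices are sorted anyway.

*The binomials are a Gröbner basis of the kernel.* The Segre map sends an ordered monomial to a
nonzero multiple of `x_u ⊗ y_v`, where `u` and `v` are its sorted first and second indices. Among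
the ordered monomials with the same `u` and `v`, the one with sorted second indices is the least
(`le_of_snds_sorted`). If the leading monomial of a nonzero element of the kernel were of this kind,
no other monomial of the element could contribute to the coefficient of `x_u ⊗ y_v` in its image,
which would thus be nonzero (`not_snds_sorted_leadingMonomial`).

*The binomials generate the kernel.* Modulo the binomials, and up to nonzero scalars, the second
indices of two adjacent generators can be exchanged, so every ordered monomial can be replaced by
one with sorted second indices (`scalarCongr_prod_pairs`). This gives, for an element of the kernel,
a congruent element of the kernel without divisible monomials, which is zero by the Gröbner property
(`span_segreBinomials`).

*Reducedness.* The monomials of the binomials all have length two, the leading ones are distinct,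
and the trailing ones have sorted second indices. So the only divisibility between a monomial of a
binomial and a leading monomial is the trivial one (`segreBinomial_eq_of_eq_starMul`).
-/

noncomputable section

/-! ### Products of ordered monomials -/

namespace Term

variable {I : Type*} [LinearOrder I]

/-- The ordered monomial obtained by sorting the letters of a word. -/
def ofList (l : List I) : Term I :=
  ⟨l.insertionSort (· ≤ ·), List.pairwise_insertionSort _ l⟩

theorem ofList_word_perm (l : List I) : (ofList l).word.Perm l :=
  List.perm_insertionSort _ l

theorem eq_of_perm {u v : Term I} (h : u.word.Perm v.word) : u = v :=
  Term.ext (h.eq_of_pairwise' u.sorted v.sorted)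

theorem le_of_word_le {u v : Term I} (hl : u.word.length = v.word.length)
    (h : u.word ≤ v.word) : u ≤ v := by
  change key u ≤ key v
  rw [Prod.Lex.le_iff]
  exact Or.inr ⟨hl, h⟩

end Term

namespace QuantumSpace

variable {I : Type*} [LinearOrder I]

theorem coeff_ne_zero {q : Matrix I I ℂ} (hq : ∀ i j, q i j ≠ 0) (i : I) (l : List I) :
    coeff q i l ≠ 0 := by
  refine List.prod_ne_zero fun h => ?_
  obtain ⟨k, -, hk⟩ := List.mem_map.1 h
  split_ifs at hk
  · exact hq i k hk
  · exact one_ne_zero hk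

theorem exists_prod_gen_eq_smul_mon {q : Matrix I I ℂ} (hq : ∀ i j, q i j ≠ 0) (l : List I) :
    ∃ c : ℂ, c ≠ 0 ∧ (l.map (gen q)).prod = c • mon q (Term.ofList l) := by
  induction l with
  | nil => exact ⟨1, one_ne_zero, by simp [mon, Term.ofList]⟩
  | cons i l ih =>
    obtain ⟨c, hc, h⟩ := ih
    refine ⟨c * coeff q i (Term.ofList l).word, mul_ne_zero hc (coeff_ne_zero hq _ _), ?_⟩
    rw [List.map_cons, List.prod_cons, h, mul_smul_comm, gen_mul_mon, smul_smul]
    rfl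

theorem leadingMonomial_eq_of_forall_le {q : Matrix I I ℂ} {f : QuantumSpace q} {u : Term I}
    (hu : normalForm q f u ≠ 0) (h : ∀ w, normalForm q f w ≠ 0 → w ≤ u) :
    leadingMonomial q f = u := by
  have : (normalForm q f).support.max = (u : WithBot (Term I)) := by
    apply le_antisymm
    · exact Finset.max_le fun w hw => WithBot.coe_le_coe.2 (h w (Finsupp.mem_support_iff.1 hw))
    · exact Finset.le_max (Finsupp.mem_support_iff.2 hu)
  rw [leadingMonomial, this]
  rfl

theorem exists_max_eq_leadingMonomial {q : Matrix I I ℂ} {f : QuantumSpace q} (hf : f ≠ 0) :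
    (normalForm q f).support.max = (leadingMonomial q f : WithBot (Term I)) := by
  obtain ⟨w, hw⟩ : (normalForm q f).support.Nonempty := by
    rw [Finsupp.support_nonempty_iff]
    simpa using hf
  obtain ⟨b, hb⟩ := Finset.max_of_mem hw
  rw [leadingMonomial, hb]
  rfl

theorem normalForm_leadingMonomial_ne_zero {q : Matrix I I ℂ} {f : QuantumSpace q} (hf : f ≠ 0) :
    normalForm q f (leadingMonomial q f) ≠ 0 :=
  Finsupp.mem_support_iff.1 (Finset.mem_of_max (exists_max_eq_leadingMonomial hf))

theorem le_leadingMonomial {q : Matrix I I ℂ} {f : QuantumSpace q} {w : Term I}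
    (hw : normalForm q f w ≠ 0) : w ≤ leadingMonomial q f := by
  have hf : f ≠ 0 := by
    rintro rfl
    simp at hw
  exact Finset.le_max_of_eq (Finsupp.mem_support_iff.2 hw) (exists_max_eq_leadingMonomial hf)

theorem leadingMonomial_smul_mon {q : Matrix I I ℂ} {c : ℂ} (hc : c ≠ 0) (w : Term I) :
    leadingMonomial q (c • mon q w) = w := by
  apply leadingMonomial_eq_of_forall_le
  · simpa [normalForm_mon] using hc
  · intro v hv
    by_contra hne
    have : w ≠ v := fun h => hne h.ge
    simp [normalForm_mon, this] at hv

/-- Since all the entries of the matrix are nonzero, `u ⋆ v` is the commutative product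
of `u` and `v`, that is, the sum of the multisets of their letters. -/
theorem starMul_eq {q : Matrix I I ℂ} (hq : ∀ i j, q i j ≠ 0) (u v : Term I) :
    starMul q u v = Term.ofList (u.word ++ v.word) := by
  obtain ⟨c, hc, h⟩ := exists_prod_gen_eq_smul_mon hq (u.word ++ v.word)
  rw [starMul, mon, mon, ← List.prod_append, ← List.map_append, h, leadingMonomial_smul_mon hc]

theorem starMul_starMul_word_perm {q : Matrix I I ℂ} (hq : ∀ i j, q i j ≠ 0) (a u b : Term I) :
    (starMul q (starMul q a u) b).word.Perm (a.word ++ u.word ++ b.word) := by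
  rw [starMul_eq hq, starMul_eq hq]
  exact (Term.ofList_word_perm _).trans ((Term.ofList_word_perm _).append_right _)

theorem exists_eq_starMul_of_subperm {q : Matrix I I ℂ} (hq : ∀ i j, q i j ≠ 0) {u w : Term I}
    (h : u.word.Subperm w.word) : ∃ a b : Term I, w = starMul q (starMul q a u) b := by
  obtain ⟨l', hl', hs⟩ := h
  obtain ⟨l, hl⟩ := hs.exists_perm_append
  replace hl := hl.trans (hl'.append_right l)
  refine ⟨Term.one, Term.ofList l, Term.eq_of_perm (hl.trans ?_)⟩
  refine List.Perm.trans ?_ (starMul_starMul_word_perm hq _ _ _).symm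
  exact (Term.ofList_word_perm l).symm.append_left _

theorem eq_of_eq_starMul_of_length_eq {q : Matrix I I ℂ} (hq : ∀ i j, q i j ≠ 0)
    {u w a b : Term I} (hl : w.word.length = u.word.length)
    (h : w = starMul q (starMul q a u) b) : w = u := by
  have hp := starMul_starMul_word_perm hq a u b
  rw [← h] at hp
  have hlen := hp.length_eq
  simp only [List.length_append] at hlen
  have ha : a.word = [] := List.length_eq_zero_iff.1 (by omega)
  have hb : b.word = [] := List.length_eq_zero_iff.1 (by omega)
  rw [ha, hb] at hp
  exact Term.eq_of_perm (by simpa using hp)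

end QuantumSpace

/-! ### Congruence up to a nonzero scalar -/

/-- Congruence of `x` and a nonzero scalar multiple of `y` modulo the two-sided ideal `K`. -/
def ScalarCongr {A : Type*} [Ring A] [Algebra ℂ A] (K : TwoSidedIdeal A) (x y : A) : Prop :=
  ∃ c : ℂ, c ≠ 0 ∧ x - c • y ∈ K

namespace ScalarCongr

variable {A : Type*} [Ring A] [Algebra ℂ A] {K : TwoSidedIdeal A} {x y z x' y' : A}

theorem smul_mem (c : ℂ) (hx : x ∈ K) : c • x ∈ K := by
  rw [Algebra.smul_def]
  exact K.mul_mem_left _ _ hx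

theorem of_eq_smul {c : ℂ} (hc : c ≠ 0) (h : x = c • y) : ScalarCongr K x y :=
  ⟨c, hc, by rw [h, sub_self]; exact K.zero_mem⟩

theorem refl (x : A) : ScalarCongr K x x :=
  of_eq_smul one_ne_zero (one_smul ℂ x).symm

theorem symm (h : ScalarCongr K x y) : ScalarCongr K y x := by
  obtain ⟨c, hc, h⟩ := h
  refine ⟨c⁻¹, inv_ne_zero hc, ?_⟩
  have := smul_mem (-c⁻¹) h
  rwa [smul_sub, smul_smul, neg_mul, inv_mul_cancel₀ hc, neg_smul, neg_smul, one_smul,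
    sub_neg_eq_add, add_comm, ← sub_eq_add_neg] at this

theorem trans (h : ScalarCongr K x y) (h' : ScalarCongr K y z) : ScalarCongr K x z := by
  obtain ⟨c, hc, h⟩ := h
  obtain ⟨d, hd, h'⟩ := h'
  refine ⟨c * d, mul_ne_zero hc hd, ?_⟩
  have := K.add_mem h (smul_mem c h')
  rwa [smul_sub, smul_smul, sub_add_sub_cancel] at this

theorem mul (h : ScalarCongr K x y) (h' : ScalarCongr K x' y') :
    ScalarCongr K (x * x') (y * y') := by
  obtain ⟨c, hc, h⟩ := h
  obtain ⟨d, hd, h'⟩ := h'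
  refine ⟨c * d, mul_ne_zero hc hd, ?_⟩
  have := K.add_mem (K.mul_mem_right _ x' h) (K.mul_mem_left (c • y) _ h')
  rwa [sub_mul, mul_sub, sub_add_sub_cancel, smul_mul_smul_comm] at this

end ScalarCongr

/-! ### Ordered monomials in the variables `z_{iα}` -/

section Words

variable {I J : Type*}

/-- The word formed by the first indices of the letters. -/
def fsts (l : List (I ×ₗ J)) : List I := l.map fun p => (ofLex p).1

/-- The word formed by the second indices of the letters. -/
def snds (l : List (I ×ₗ J)) : List J := l.map fun p => (ofLex p).2

/-- The word with first indices `l` and second indices `k`; it is cut to the shorter of the two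
lists. -/
def pairs (l : List I) (k : List J) : List (I ×ₗ J) :=
  List.zipWith (fun i α => toLex (i, α)) l k

theorem pairs_fsts_snds (l : List (I ×ₗ J)) : pairs (fsts l) (snds l) = l := by
  induction l with
  | nil => rfl
  | cons p l ih => exact congrArg (p :: ·) ih

theorem snds_pairs {l : List I} {k : List J} (h : l.length = k.length) :
    snds (pairs l k) = k := by
  induction l generalizing k with
  | nil => cases k <;> simp_all [snds, pairs]
  | cons i l ih =>
    cases k with
    | nil => simp at h
    | cons α k => exact congrArg (α :: ·) (ih (by simpa using h))

variable [LinearOrder I] [LinearOrder J]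

theorem fsts_sorted (w : Term (I ×ₗ J)) : (fsts w.word).Pairwise (· ≤ ·) := by
  refine List.pairwise_map.2 (w.sorted.imp fun {a b} h => ?_)
  rcases Prod.Lex.le_iff.1 h with h | h
  · exact h.le
  · exact h.1.le

theorem pairs_sorted {l : List I} {k : List J} (hl : l.Pairwise (· ≤ ·))
    (hk : k.Pairwise (· ≤ ·)) : (pairs l k).Pairwise (· ≤ ·) := by
  induction l generalizing k with
  | nil => simp [pairs]
  | cons i l ih =>
    cases k with
    | nil => simp [pairs]
    | cons α k =>
      rw [List.pairwise_cons] at hl hk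
      refine List.pairwise_cons.2 ⟨fun p hp => ?_, ih hl.2 hk.2⟩
      obtain ⟨n, hn, rfl⟩ := List.getElem_of_mem hp
      simp only [List.getElem_zipWith, Prod.Lex.le_iff, ofLex_toLex]
      rcases (hl.1 _ (List.getElem_mem _)).lt_or_eq with h | h
      · exact Or.inl h
      · exact Or.inr ⟨h, hk.1 _ (List.getElem_mem _)⟩

/-- Among the words with given first indices and given multiset of second indices, the least one
is the one whose second indices are sorted. -/
theorem le_of_snds_sorted {l l' : List (I ×ₗ J)} (hf : fsts l = fsts l')
    (hp : (snds l).Perm (snds l')) (hs : (snds l).Pairwise (· ≤ ·)) : l ≤ l' := by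
  induction l generalizing l' with
  | nil =>
    cases l' with
    | nil => exact le_rfl
    | cons p' l' => simp [fsts] at hf
  | cons p l ih =>
    cases l' with
    | nil => simp [fsts] at hf
    | cons p' l' =>
      simp only [fsts, snds, List.map_cons, List.cons.injEq, List.pairwise_cons] at hf hp hs
      have hle : (ofLex p).2 ≤ (ofLex p').2 := by
        rcases List.mem_cons.1 (hp.mem_iff.2 List.mem_cons_self) with h | h
        · exact h.ge
        · exact hs.1 _ h
      rw [← not_lt, List.cons_lt_cons_iff, Prod.Lex.lt_iff]
      rintro ((h | h) | ⟨rfl, h⟩)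
      · exact h.ne' hf.1
      · exact h.2.not_ge hle
      · exact (ih hf.2 hp.cons_inv hs.2).not_gt h

/-- The word of the ordered monomial `z_{iα} z_{jβ}`, for `i < j`. -/
def pairTerm {i j : I} (h : i < j) (α β : J) : Term (I ×ₗ J) :=
  ⟨[toLex (i, α), toLex (j, β)], by simp [Prod.Lex.le_iff, h]⟩

/-- An ordered monomial whose second indices are not sorted is a multiple of some
`z_{iβ} z_{jα}` with `i < j` and `α < β`. -/
theorem exists_pairTerm_subperm {w : Term (I ×ₗ J)} (h : ¬ (snds w.word).Pairwise (· ≤ ·)) :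
    ∃ (i j : I) (α β : J) (hij : i < j), α < β ∧ (pairTerm hij β α).word.Subperm w.word := by
  by_contra! H
  refine h (List.pairwise_map.2 (List.pairwise_iff_forall_sublist.2 fun {a b} hab => ?_))
  by_contra hlt
  rw [not_le] at hlt
  have hle : a ≤ b := List.pairwise_iff_forall_sublist.1 w.sorted hab
  rcases Prod.Lex.le_iff.1 hle with h' | h'
  · exact H _ _ _ _ h' hlt hab.subperm
  · exact h'.2.not_gt hlt

end Words

/-! ### The Segre map on ordered monomials -/

section Segre

open QuantumSpace

variable {I J : Type*} {q : Matrix I I ℂ} {q' : Matrix J J ℂ}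

theorem segreMatrix_isMultAntisymm (hq : IsMultAntisymm q) (hq' : IsMultAntisymm q') :
    IsMultAntisymm (segreMatrix q q') where
  ne_zero _ _ := mul_ne_zero (hq.ne_zero _ _) (hq'.ne_zero _ _)
  inv_eq a b := by
    change q _ _ * q' _ _ = (q _ _ * q' _ _)⁻¹
    rw [mul_inv, ← hq.inv_eq, ← hq'.inv_eq]
  diag a := by
    change q _ _ * q' _ _ = 1
    rw [hq.diag, hq'.diag, one_mul]

variable [LinearOrder I] [LinearOrder J]

theorem segreMap_mon (hq : IsMultAntisymm q) (hq' : IsMultAntisymm q') (w : Term (I ×ₗ J)) :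
    segreMap q q' hq hq' (mon _ w) =
      ((fsts w.word).map (gen q)).prod ⊗ₜ[ℂ] ((snds w.word).map (gen q')).prod := by
  rw [mon]
  induction w.word with
  | nil => simp [fsts, snds, Algebra.TensorProduct.one_def]
  | cons p l ih =>
    rw [List.map_cons, List.prod_cons, map_mul, ih]
    simp [segreMap, fsts, snds, Algebra.TensorProduct.tmul_mul_tmul]

/-- The coefficient of `x_u ⊗ y_v` in an element of the tensor product, for ordered monomials
`x_u` and `y_v`. -/
def tensorCoord (q : Matrix I I ℂ) (q' : Matrix J J ℂ) (u : Term I) (v : Term J) :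
    QuantumSpace q ⊗[ℂ] QuantumSpace q' →ₗ[ℂ] ℂ :=
  (LinearMap.mul' ℂ ℂ).comp (TensorProduct.map
    ((Finsupp.lapply u).comp (normalForm q).toLinearMap)
    ((Finsupp.lapply v).comp (normalForm q').toLinearMap))

theorem tensorCoord_tmul (u : Term I) (v : Term J) (f : QuantumSpace q) (g : QuantumSpace q') :
    tensorCoord q q' u v (f ⊗ₜ g) = normalForm q f u * normalForm q' g v := rfl

theorem word_perm_of_normalForm_prod_ne_zero (hq : ∀ i j, q i j ≠ 0) {l : List I} {u : Term I}
    (h : normalForm q (l.map (gen q)).prod u ≠ 0) : u.word.Perm l := by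
  obtain ⟨c, -, hl⟩ := exists_prod_gen_eq_smul_mon hq l
  have : Term.ofList l = u := by
    by_contra hne
    simp [hl, normalForm_mon, hne] at h
  rw [← this]
  exact Term.ofList_word_perm l

/-- The leading monomial of a nonzero element of the kernel cannot have sorted second indices:
otherwise its image under the Segre map is an ordered monomial that no smaller monomial
produces, and that monomial would survive in the image of the element. -/
theorem not_snds_sorted_leadingMonomial (hq : IsMultAntisymm q) (hq' : IsMultAntisymm q')
    {h : QuantumSpace (segreMatrix q q')} (hker : segreMap q q' hq hq' h = 0) (h0 : h ≠ 0) :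
    ¬ (snds (leadingMonomial _ h).word).Pairwise (· ≤ ·) := by
  intro hs
  set w := leadingMonomial _ h
  set u : Term I := ⟨fsts w.word, fsts_sorted w⟩
  set v : Term J := ⟨snds w.word, hs⟩
  set φ := (tensorCoord q q' u v).comp (segreMap q q' hq hq').toLinearMap
  have hw : φ (mon _ w) = 1 := by
    have h1 : normalForm q ((fsts w.word).map (gen q)).prod = Finsupp.single u 1 :=
      normalForm_mon q u
    have h2 : normalForm q' ((snds w.word).map (gen q')).prod = Finsupp.single v 1 :=
      normalForm_mon q' v
    simp only [φ, LinearMap.comp_apply, AlgHom.toLinearMap_apply, segreMap_mon,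
      tensorCoord_tmul, h1, h2]
    simp
  have hne : ∀ t, normalForm _ h t ≠ 0 → t ≠ w → φ (mon _ t) = 0 := by
    intro t ht htw
    by_contra hφ
    simp only [φ, LinearMap.comp_apply, AlgHom.toLinearMap_apply, segreMap_mon,
      tensorCoord_tmul] at hφ
    have hu := word_perm_of_normalForm_prod_ne_zero hq.ne_zero (left_ne_zero_of_mul hφ)
    have hv := word_perm_of_normalForm_prod_ne_zero hq'.ne_zero (right_ne_zero_of_mul hφ)
    have hf : fsts w.word = fsts t.word := hu.eq_of_pairwise' u.sorted (fsts_sorted t)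
    have hl : w.word.length = t.word.length := by
      simpa [fsts] using congrArg List.length hf
    have hle : w ≤ t := Term.le_of_word_le hl (le_of_snds_sorted hf hv hs)
    exact htw (le_antisymm (le_leadingMonomial ht) hle)
  have hsum : φ h = normalForm _ h w := by
    conv_lhs => rw [← (normalForm _).symm_apply_apply h, normalForm_symm_apply,
      Finsupp.linearCombination_apply, Finsupp.sum, map_sum]
    rw [Finset.sum_eq_single w]
    · rw [map_smul, hw, smul_eq_mul, mul_one]
    · intro t ht htw
      rw [map_smul, hne t (Finsupp.mem_support_iff.1 ht) htw, smul_zero]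
    · intro hnot
      rw [Finsupp.notMem_support_iff.1 hnot, zero_smul, map_zero]
  have hφ0 : φ h = 0 := by
    simp [φ, hker]
  exact normalForm_leadingMonomial_ne_zero h0 (hsum.symm.trans hφ0)

/-! ### The binomials -/

/-- The binomial `z_{iβ} z_{jα} - q'_{βα} z_{iα} z_{jβ}`. -/
def segreBinomial (q : Matrix I I ℂ) (q' : Matrix J J ℂ) (i j : I) (α β : J) :
    QuantumSpace (segreMatrix q q') :=
  zGen q q' i β * zGen q q' j α - q' β α • (zGen q q' i α * zGen q q' j β)

theorem mon_pairTerm {i j : I} (h : i < j) (α β : J) :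
    mon (segreMatrix q q') (pairTerm h α β) = zGen q q' i α * zGen q q' j β := by
  simp [mon, pairTerm, zGen]

theorem pairTerm_ne {i j i' j' : I} (h : i < j) (h' : i' < j') {α β α' β' : J} (hα : α < β)
    (hα' : α' < β') : pairTerm h α β ≠ pairTerm h' β' α' := by
  intro he
  have hw := congrArg (fun t => snds t.word) he
  simp only [snds, pairTerm, List.map_cons, List.map_nil, List.cons.injEq, ofLex_toLex,
    and_true] at hw
  rw [hw.1, hw.2] at hα
  exact hα.not_gt hα'

theorem pairTerm_lt {i j : I} (h : i < j) {α β : J} (hα : α < β) :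
    pairTerm h α β < pairTerm h β α := by
  refine lt_of_le_of_ne (Term.le_of_word_le rfl ?_) (pairTerm_ne h h hα hα)
  refine le_of_snds_sorted rfl (List.Perm.swap _ _ _) ?_
  simpa [snds, pairTerm] using hα.le

theorem normalForm_segreBinomial {i j : I} (h : i < j) (α β : J) :
    normalForm _ (segreBinomial q q' i j α β) =
      Finsupp.single (pairTerm h β α) 1 - Finsupp.single (pairTerm h α β) (q' β α) := by
  rw [segreBinomial, ← mon_pairTerm h, ← mon_pairTerm h, map_sub, map_smul, normalForm_mon,
    normalForm_mon]
  simp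

theorem normalForm_segreBinomial_apply {i j : I} (h : i < j) {α β : J} (hα : α < β) :
    normalForm _ (segreBinomial q q' i j α β) (pairTerm h β α) = 1 := by
  simp [normalForm_segreBinomial h, (pairTerm_lt h hα).ne]

theorem eq_or_eq_of_normalForm_segreBinomial_ne_zero {i j : I} (h : i < j) {α β : J}
    {w : Term (I ×ₗ J)} (hw : normalForm _ (segreBinomial q q' i j α β) w ≠ 0) :
    w = pairTerm h β α ∨ w = pairTerm h α β := by
  by_contra! H
  simp [normalForm_segreBinomial h, H.1.symm, H.2.symm] at hw

theorem leadingMonomial_segreBinomial {i j : I} (h : i < j) {α β : J} (hα : α < β) :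
    leadingMonomial _ (segreBinomial q q' i j α β) = pairTerm h β α := by
  apply leadingMonomial_eq_of_forall_le
  · simp [normalForm_segreBinomial_apply h hα]
  · intro w hw
    rcases eq_or_eq_of_normalForm_segreBinomial_ne_zero h hw with rfl | rfl
    · exact le_rfl
    · exact (pairTerm_lt h hα).le

theorem segreBinomial_ne_zero {i j : I} (h : i < j) {α β : J} (hα : α < β) :
    segreBinomial q q' i j α β ≠ 0 := by
  intro h0
  have := normalForm_segreBinomial_apply (q := q) (q' := q') h hα
  simp [h0] at this

theorem pairTerm_injective {i j i' j' : I} {h : i < j} {h' : i' < j'} {α β α' β' : J}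
    (he : pairTerm h β α = pairTerm h' β' α') : i = i' ∧ j = j' ∧ α = α' ∧ β = β' := by
  have hw := congrArg Term.word he
  simp only [pairTerm, List.cons.injEq, EmbeddingLike.apply_eq_iff_eq, Prod.mk.injEq,
    and_true] at hw
  exact ⟨hw.1.1, hw.2.1, hw.2.2, hw.1.2⟩

theorem segreBinomial_mem_ker (hq : IsMultAntisymm q) (hq' : IsMultAntisymm q') (i j : I)
    (α β : J) : segreMap q q' hq hq' (segreBinomial q q' i j α β) = 0 := by
  rw [segreBinomial, map_sub, map_smul, map_mul, map_mul, segreMap_zGen, segreMap_zGen,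
    segreMap_zGen, segreMap_zGen, Algebra.TensorProduct.tmul_mul_tmul,
    Algebra.TensorProduct.tmul_mul_tmul, gen_mul_gen q' hq' β α, TensorProduct.tmul_smul, sub_self]

theorem isGroebnerBasis_segreBinomials (hq : IsMultAntisymm q) (hq' : IsMultAntisymm q') :
    IsGroebnerBasis (segreMatrix q q') (TwoSidedIdeal.ker (segreMap q q' hq hq'))
      (segreBinomials q q') := by
  refine ⟨?_, fun h hh h0 => ?_⟩
  · rintro _ ⟨i, j, α, β, -, -, rfl⟩
    exact (TwoSidedIdeal.mem_ker _).2 (segreBinomial_mem_ker hq hq' i j α β)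
  · obtain ⟨i, j, α, β, hij, hα, hsub⟩ := exists_pairTerm_subperm
      (not_snds_sorted_leadingMonomial hq hq' ((TwoSidedIdeal.mem_ker _).1 hh) h0)
    refine ⟨segreBinomial q q' i j α β, ⟨i, j, α, β, hij, hα, rfl⟩,
      segreBinomial_ne_zero hij hα, ?_⟩
    rw [leadingMonomial_segreBinomial hij hα]
    exact exists_eq_starMul_of_subperm (segreMatrix_isMultAntisymm hq hq').ne_zero hsub

/-! ### The binomials generate the kernel -/

section Exchange

variable {K : TwoSidedIdeal (QuantumSpace (segreMatrix q q'))}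

theorem scalarCongr_swap_snd_of_lt (hq' : IsMultAntisymm q') (hK : segreBinomials q q' ⊆ K)
    {i j : I} (h : i < j) (α β : J) :
    ScalarCongr K (zGen q q' i α * zGen q q' j β) (zGen q q' i β * zGen q q' j α) := by
  rcases lt_trichotomy α β with hα | rfl | hα
  · exact ScalarCongr.symm ⟨q' β α, hq'.ne_zero _ _, hK ⟨i, j, α, β, h, hα, rfl⟩⟩
  · exact ScalarCongr.refl _
  · exact ⟨q' α β, hq'.ne_zero _ _, hK ⟨i, j, β, α, h, hα, rfl⟩⟩

theorem scalarCongr_comm (hq : IsMultAntisymm q) (hq' : IsMultAntisymm q') (i j : I) (α β : J) :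
    ScalarCongr K (zGen q q' i α * zGen q q' j β) (zGen q q' j β * zGen q q' i α) :=
  ScalarCongr.of_eq_smul ((segreMatrix_isMultAntisymm hq hq').ne_zero _ _)
    (gen_mul_gen _ (segreMatrix_isMultAntisymm hq hq') _ _)

theorem scalarCongr_swap_snd (hq : IsMultAntisymm q) (hq' : IsMultAntisymm q')
    (hK : segreBinomials q q' ⊆ K) (i j : I) (α β : J) :
    ScalarCongr K (zGen q q' i α * zGen q q' j β) (zGen q q' i β * zGen q q' j α) := by
  rcases lt_trichotomy i j with h | rfl | h
  · exact scalarCongr_swap_snd_of_lt hq' hK h α β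
  · exact scalarCongr_comm hq hq' i i α β
  · exact ((scalarCongr_comm hq hq' i j α β).trans
      (scalarCongr_swap_snd_of_lt hq' hK h β α)).trans (scalarCongr_comm hq hq' j i α β)

/-- Modulo the binomials, the second indices of a product of generators can be permuted. -/
theorem scalarCongr_prod_pairs (hq : IsMultAntisymm q) (hq' : IsMultAntisymm q')
    (hK : segreBinomials q q' ⊆ K) {k k' : List J} (hp : k.Perm k') :
    ∀ l : List I, l.length = k.length →
      ScalarCongr K ((pairs l k).map (gen (segreMatrix q q'))).prod
        ((pairs l k').map (gen (segreMatrix q q'))).prod := by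
  induction hp with
  | nil => exact fun l _ => ScalarCongr.refl _
  | cons α _ ih =>
    intro l hl
    match l, hl with
    | i :: l, hl =>
      simp only [pairs, List.zipWith_cons_cons, List.map_cons, List.prod_cons]
      exact (ScalarCongr.refl _).mul (ih l (by simpa using hl))
  | swap α β k =>
    intro l hl
    match l, hl with
    | i :: j :: l, hl =>
      simp only [pairs, List.zipWith_cons_cons, List.map_cons, List.prod_cons, ← mul_assoc]
      exact (scalarCongr_swap_snd hq hq' hK i j β α).mul (ScalarCongr.refl _)
  | trans hp₁ _ ih₁ ih₂ =>
    exact fun l hl => (ih₁ l hl).trans (ih₂ l (hl.trans hp₁.length_eq))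

theorem exists_snds_sorted_scalarCongr_mon (hq : IsMultAntisymm q) (hq' : IsMultAntisymm q')
    (hK : segreBinomials q q' ⊆ K) (w : Term (I ×ₗ J)) :
    ∃ t : Term (I ×ₗ J), (snds t.word).Pairwise (· ≤ ·) ∧
      ScalarCongr K (mon (segreMatrix q q') w) (mon (segreMatrix q q') t) := by
  have hlen : (fsts w.word).length = (snds w.word).length := by simp [fsts, snds]
  set k := Term.ofList (snds w.word)
  have hk : k.word.Perm (snds w.word) := Term.ofList_word_perm _
  refine ⟨⟨pairs (fsts w.word) k.word, pairs_sorted (fsts_sorted w) k.sorted⟩, ?_, ?_⟩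
  · rw [snds_pairs (hlen.trans hk.length_eq.symm)]
    exact k.sorted
  · have := scalarCongr_prod_pairs hq hq' hK hk.symm (fsts w.word) hlen
    rwa [pairs_fsts_snds] at this

/-- Every element is congruent to a linear combination of ordered monomials whose second indices
are sorted. -/
theorem exists_snds_sorted_sub_mem (hq : IsMultAntisymm q) (hq' : IsMultAntisymm q')
    (hK : segreBinomials q q' ⊆ K) (h : QuantumSpace (segreMatrix q q')) :
    ∃ g, h - g ∈ K ∧ ∀ t, normalForm _ g t ≠ 0 → (snds t.word).Pairwise (· ≤ ·) := by
  obtain ⟨c, rfl⟩ := (normalForm (segreMatrix q q')).symm.surjective h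
  induction c using Finsupp.induction_linear with
  | zero => exact ⟨0, by simp, by simp⟩
  | add a b ha hb =>
    obtain ⟨f, hf, hf'⟩ := ha
    obtain ⟨g, hg, hg'⟩ := hb
    refine ⟨f + g, ?_, fun t ht => ?_⟩
    · rw [map_add, add_sub_add_comm]
      exact K.add_mem hf hg
    · by_contra hn
      have h1 := not_not.1 (mt (hf' t) hn)
      have h2 := not_not.1 (mt (hg' t) hn)
      simp [h1, h2] at ht
  | single w c =>
    obtain ⟨t, ht, d, -, hd⟩ := exists_snds_sorted_scalarCongr_mon hq hq' hK w
    refine ⟨c • d • mon _ t, ?_, fun s hs => ?_⟩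
    · rw [normalForm_symm_apply, Finsupp.linearCombination_single, ← smul_sub]
      exact ScalarCongr.smul_mem c hd
    · have : t = s := by
        by_contra hne
        simp [normalForm_mon, hne] at hs
      exact this ▸ ht

end Exchange

theorem span_segreBinomials (hq : IsMultAntisymm q) (hq' : IsMultAntisymm q') :
    TwoSidedIdeal.span (segreBinomials q q') = TwoSidedIdeal.ker (segreMap q q' hq hq') := by
  have hle : TwoSidedIdeal.span (segreBinomials q q') ≤
      TwoSidedIdeal.ker (segreMap q q' hq hq') :=
    TwoSidedIdeal.span_le.2 (isGroebnerBasis_segreBinomials hq hq').1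
  refine le_antisymm hle fun h hh => ?_
  obtain ⟨g, hg, hsort⟩ := exists_snds_sorted_sub_mem hq hq' TwoSidedIdeal.subset_span h
  -- The reduced form `g` lies in the kernel and has sorted monomials only, so it vanishes.
  have hg0 : g = 0 := by
    by_contra hne
    have hmem : g ∈ TwoSidedIdeal.ker (segreMap q q' hq hq') := by
      have := TwoSidedIdeal.sub_mem _ hh (hle hg)
      rwa [sub_sub_self] at this
    have hker : segreMap q q' hq hq' g = 0 := (TwoSidedIdeal.mem_ker _).1 hmem
    exact not_snds_sorted_leadingMonomial hq hq' hker hne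
      (hsort _ (normalForm_leadingMonomial_ne_zero hne))
  simpa [hg0] using hg

/-! ### Reducedness and cardinality -/

/-- The leading monomials of the binomials are distinct and of the same length, and the trailing
monomials have sorted second indices. So the only monomial of a binomial that is a multiple of the
leading monomial of a binomial is its own leading monomial. -/
theorem segreBinomial_eq_of_eq_starMul (hq : IsMultAntisymm q) (hq' : IsMultAntisymm q')
    {f g : QuantumSpace (segreMatrix q q')} (hf : f ∈ segreBinomials q q')
    (hg : g ∈ segreBinomials q q') {w : Term (I ×ₗ J)} (hw : normalForm _ f w ≠ 0)
    {a b : Term (I ×ₗ J)}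
    (h : w = starMul (segreMatrix q q')
      (starMul (segreMatrix q q') a (leadingMonomial _ g)) b) : g = f := by
  obtain ⟨i, j, α, β, hij, hα, rfl⟩ := hf
  obtain ⟨i', j', α', β', hij', hα', rfl⟩ := hg
  change normalForm _ (segreBinomial q q' i j α β) w ≠ 0 at hw
  change w = starMul _ (starMul _ a (leadingMonomial _ (segreBinomial q q' i' j' α' β'))) b at h
  rw [leadingMonomial_segreBinomial hij' hα'] at h
  have hne := (segreMatrix_isMultAntisymm hq hq').ne_zero
  rcases eq_or_eq_of_normalForm_segreBinomial_ne_zero hij hw with rfl | rfl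
  · have he : pairTerm hij β α = pairTerm hij' β' α' :=
      eq_of_eq_starMul_of_length_eq hne (by simp [pairTerm]) h
    obtain ⟨rfl, rfl, rfl, rfl⟩ := pairTerm_injective he
    rfl
  · have he : pairTerm hij α β = pairTerm hij' β' α' :=
      eq_of_eq_starMul_of_length_eq hne (by simp [pairTerm]) h
    exact absurd he (pairTerm_ne hij hij' hα hα')

theorem isReducedGroebnerBasis_segreBinomials (hq : IsMultAntisymm q)
    (hq' : IsMultAntisymm q') :
    IsReducedGroebnerBasis (segreMatrix q q') (TwoSidedIdeal.ker (segreMap q q' hq hq'))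
      (segreBinomials q q') where
  isGroebnerBasis := isGroebnerBasis_segreBinomials hq hq'
  span_eq := span_segreBinomials hq hq'
  monic := by
    rintro _ ⟨i, j, α, β, hij, hα, rfl⟩
    change normalForm _ (segreBinomial q q' i j α β)
      (leadingMonomial _ (segreBinomial q q' i j α β)) = 1
    rw [leadingMonomial_segreBinomial hij hα, normalForm_segreBinomial_apply hij hα]
  minimal := by
    intro f hf hG
    have hf0 : f ≠ 0 := by
      obtain ⟨i, j, α, β, hij, hα, rfl⟩ := hf
      exact segreBinomial_ne_zero hij hα
    obtain ⟨g, hg, -, a, b, hab⟩ :=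
      hG.2 f ((isGroebnerBasis_segreBinomials hq hq').1 f hf) hf0
    exact hg.2 (segreBinomial_eq_of_eq_starMul hq hq' hf hg.1
      (normalForm_leadingMonomial_ne_zero hf0) hab)
  reduced := fun f hf w hw g hg _ a b hab =>
    hg.2 (segreBinomial_eq_of_eq_starMul hq hq' hf hg.1 (Finsupp.mem_support_iff.1 hw) hab)

theorem encard_segreBinomials [Fintype I] [Fintype J] (q : Matrix I I ℂ) (q' : Matrix J J ℂ) :
    (segreBinomials q q').encard =
      (((Fintype.card I).choose 2 * (Fintype.card J).choose 2 : ℕ) : ℕ∞) := by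
  set S : Finset ((I × I) × (J × J)) :=
    ((Finset.univ : Finset (I × I)).filter fun p => p.1 < p.2) ×ˢ
      ((Finset.univ : Finset (J × J)).filter fun p => p.1 < p.2)
  have himage : segreBinomials q q' =
      (fun p : (I × I) × (J × J) => segreBinomial q q' p.1.1 p.1.2 p.2.1 p.2.2) '' S := by
    ext f
    constructor
    · rintro ⟨i, j, α, β, hij, hα, rfl⟩
      exact ⟨((i, j), (α, β)), by simp [S, hij, hα], rfl⟩
    · rintro ⟨⟨⟨i, j⟩, ⟨α, β⟩⟩, hp, rfl⟩
      have hp' : i < j ∧ α < β := by simpa [S] using hp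
      exact ⟨i, j, α, β, hp'.1, hp'.2, rfl⟩
  have hinj : Set.InjOn
      (fun p : (I × I) × (J × J) => segreBinomial q q' p.1.1 p.1.2 p.2.1 p.2.2) S := by
    rintro ⟨⟨i, j⟩, ⟨α, β⟩⟩ hp ⟨⟨i', j'⟩, ⟨α', β'⟩⟩ hp' he
    have h : i < j ∧ α < β := by simpa [S] using hp
    have h' : i' < j' ∧ α' < β' := by simpa [S] using hp'
    have hlm := congrArg (leadingMonomial _) he
    simp only [leadingMonomial_segreBinomial h.1 h.2,
      leadingMonomial_segreBinomial h'.1 h'.2] at hlm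
    obtain ⟨rfl, rfl, rfl, rfl⟩ := pairTerm_injective hlm
    rfl
  rw [himage, hinj.encard_image, Set.encard_coe_eq_coe_finsetCard, Finset.card_product,
    ← Finset.univ_product_univ, ← Finset.univ_product_univ, Finset.card_product_filter_lt,
    Finset.card_product_filter_lt, Finset.card_univ, Finset.card_univ]

end Segre

end

theorem mainTheorem2 (n m : ℕ) (hn : 1 ≤ n) (hm : 1 ≤ m)
    (q : Matrix (Fin (n + 1)) (Fin (n + 1)) ℂ) (q' : Matrix (Fin (m + 1)) (Fin (m + 1)) ℂ)
    (hq : IsMultAntisymm q) (hq' : IsMultAntisymm q') :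
    QuantumSpace.IsReducedGroebnerBasis (segreMatrix q q')
      (TwoSidedIdeal.ker (segreMap q q' hq hq')) (segreBinomials q q') ∧
    (segreBinomials q q').encard = (((n + 1).choose 2 * (m + 1).choose 2 : ℕ) : ℕ∞) := by
  refine ⟨isReducedGroebnerBasis_segreBinomials hq hq', ?_⟩
  have h := encard_segreBinomials q q'
  rwa [Fintype.card_fin, Fintype.card_fin] at h
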